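/- Let $G$ be a finite group. For $H\le G$ and $g\in G$ put $g^H=\{h^{-1}gh : h\in H\}$. These $H$-classes are the principal sets of a Schur ring $\mathbb{C}[G]^H$ on $G$; $(G,H)$ is a strong Gelfand pair if this Schur ring is commutative. For a principal set $P$ let $A_P$ be the $G\times G$ complex matrix with $(x,y)$ entry $1$ if $yx^{-1}\in P$ and $0$ otherwise, and let $E_P^*$ be the diagonal matrix with $(y,y)$ entry $1$ if $y\in P$ and $0$ otherwise. The Terwilliger algebra $T(G,\mathbb{C}[G]^H)$ (with base point the identity $e$) is the subalgebra of $\mathrm{Mat}_G(\mathbb{C})$ generated by all the $A_P$ and $E_P^*$, and $T(G)=T(G,\mathbb{C}[G]^G)$. Such an algebra $T$ is almost commutative if every irreducible $T$-submodule of $\mathbb{C}^G$ other than the primary module $T\hat e$ is $1$-dimensional, where $\hat e$ is the characteristic vector of $e$. A subgroup $N\trianglelefteq G$ with $\{e\}\ne N\ne G$ is a Frobenius kernel of $G$ if $C_G(x)\le N$ for every $e\ne x\in N$; a Frobenius complement is then a subgroup $K\le G$ with $NK=G$ and $N\cap K=\{e\}$. **Proposition 3.14.** Let $G$ be a finite Frobenius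 group with Frobenius kernel $H$ and cyclic Frobenius complement of order $k$. Assume that $T(H)$ is almost commutative and that $H$ has $m$ conjugacy classes. Then $(G,H)$ is a strong Gelfand pair and $$\dim_{\mathbb{C}} T(G,\mathbb{C}[G]^H)=\dim_{\mathbb{C}} T(H)+(k-1)(k-2+3m).$$ -/

import Mathlib

open scoped Classical in
/-- The class sum in `ℂ[G]` of the class of `a` under an equivalence relation on a finite group. -/
noncomputable def classSum {G : Type*} [Fintype G] (r : Setoid G) (a : G) :
    MonoidAlgebra ℂ G :=
  ∑ x : G with r a x, MonoidAlgebra.single x (1 : ℂ)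

/-- A Schur ring on a finite group `G`, given by its partition into principal sets (the classes of
`rel`): `{1}` is a principal set, the inverse of a principal set is a principal set, and the linear
span of the class sums is closed under multiplication in `ℂ[G]`. -/
structure SchurRing (G : Type*) [Group G] [Fintype G] where
  rel : Setoid G
  one_singleton : ∀ x : G, rel 1 x → x = 1
  inv_rel : ∀ x y : G, rel x y → rel x⁻¹ y⁻¹
  mul_mem_span : ∀ a b : G,
    classSum rel a * classSum rel b ∈ Submodule.span ℂ (Set.range (classSum rel))

namespace SchurRing

variable {G : Type*} [Group G] [Fintype G]

/-- A Schur ring is commutative if it is so as a ring, i.e. if the class sums commute. -/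
def IsCommutative (S : SchurRing G) : Prop :=
  ∀ a b : G, Commute (classSum S.rel a) (classSum S.rel b)

/-- The principal set that contains `g`. -/
def principalSet (S : SchurRing G) (g : G) : Set G := {x | S.rel g x}

open scoped Classical in
/-- The adjacency matrix of the relation `{(x, y) : y x⁻¹ ∈ P}`, with `P` the principal set
of `g`; these relations form the association scheme of the Schur ring. -/
noncomputable def adjMatrix (S : SchurRing G) (g : G) : Matrix G G ℂ :=
  Matrix.of fun x y => if y * x⁻¹ ∈ S.principalSet g then 1 else 0

open scoped Classical in
/-- The dual idempotent `E*` of the principal set of `g` with respect to the base point `1`: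
the diagonal matrix whose `y`-th entry is the `(1, y)` entry of the adjacency matrix. -/
noncomputable def dualIdempotent (S : SchurRing G) (g : G) : Matrix G G ℂ :=
  Matrix.diagonal fun y => S.adjMatrix g 1 y

/-- The Terwilliger algebra of (the association scheme of) a Schur ring, with base point `1`. -/
noncomputable def terwilligerAlgebra [DecidableEq G] (S : SchurRing G) :
    Subalgebra ℂ (Matrix G G ℂ) :=
  Algebra.adjoin ℂ (Set.range S.adjMatrix ∪ Set.range S.dualIdempotent)

end SchurRing

section Modules

variable {X : Type*} [Fintype X] [DecidableEq X]

/-- `W` is a `T`-submodule of the standard module `ℂ^X`. -/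
def IsMatrixSubmodule (T : Subalgebra ℂ (Matrix X X ℂ)) (W : Submodule ℂ (X → ℂ)) : Prop :=
  ∀ M ∈ T, ∀ v ∈ W, M.mulVec v ∈ W

/-- `W` is an irreducible `T`-submodule of the standard module `ℂ^X`. -/
def IsIrreducibleMatrixSubmodule (T : Subalgebra ℂ (Matrix X X ℂ))
    (W : Submodule ℂ (X → ℂ)) : Prop :=
  IsMatrixSubmodule T W ∧ W ≠ ⊥ ∧
    ∀ U : Submodule ℂ (X → ℂ), IsMatrixSubmodule T U → U ≤ W → U = ⊥ ∨ U = W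

/-- The primary `T`-module: the submodule `T x̂` of `ℂ^X` generated by the characteristic vector
of the base point `x`. -/
noncomputable def primaryModule (T : Subalgebra ℂ (Matrix X X ℂ)) (x : X) :
    Submodule ℂ (X → ℂ) :=
  Submodule.span ℂ {w | ∃ M ∈ T, w = M.mulVec (Pi.single x 1)}

/-- An algebra `T` of matrices with base point `x` is almost commutative if every irreducible
`T`-module other than the primary one is one-dimensional. -/
def IsAlmostCommutative (T : Subalgebra ℂ (Matrix X X ℂ)) (x : X) : Prop :=
  ∀ W : Submodule ℂ (X → ℂ), IsIrreducibleMatrixSubmodule T W → W ≠ primaryModule T x →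
    Module.finrank ℂ W = 1

end Modules

section HClasses

variable {G : Type*} [Group G]

/-- The equivalence relation whose classes are `g^H = {h⁻¹ g h : h ∈ H}`. -/
def hClassSetoid (H : Subgroup G) : Setoid G where
  r x y := ∃ h ∈ H, h⁻¹ * x * h = y
  iseqv :=
    { refl := fun x => ⟨1, H.one_mem, by simp⟩
      symm := by
        rintro x y ⟨h, hh, rfl⟩
        exact ⟨h⁻¹, H.inv_mem hh, by group⟩
      trans := by
        rintro x y z ⟨h, hh, rfl⟩ ⟨h', hh', rfl⟩
        exact ⟨h * h', H.mul_mem hh hh', by group⟩ }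

open scoped Classical in
theorem coeff_classSum {G : Type*} [Fintype G] (r : Setoid G) (a x : G) :
    (classSum r a).coeff x = if r a x then (1 : ℂ) else 0 := by
  simp [classSum, MonoidAlgebra.coeff_sum, Finsupp.finsetSum_apply, Finsupp.single_apply,
    Finset.sum_ite_eq']

/-- Elements of `ℂ[G]` that are constant on the classes lie in the span of the class sums. -/
theorem mem_span_classSum {G : Type*} [Fintype G] (r : Setoid G) (f : MonoidAlgebra ℂ G)
    (hf : ∀ x y, r x y → f.coeff x = f.coeff y) :
    f ∈ Submodule.span ℂ (Set.range (classSum r)) := by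
  classical
  have h : f = ∑ q : Quotient r, f.coeff q.out • classSum r q.out := by
    ext x
    rw [MonoidAlgebra.coeff_sum, Finsupp.finsetSum_apply, Finset.sum_eq_single (Quotient.mk r x)]
    · have h1 : r (Quotient.mk r x).out x := Quotient.mk_out x
      simp [coeff_classSum, h1, hf _ _ h1]
    · intro q _ hq
      have h1 : ¬ r q.out x := fun h2 => hq (by rw [← Quotient.sound h2, Quotient.out_eq])
      simp [coeff_classSum, h1]
    · simp
  rw [h]
  exact Submodule.sum_mem _ fun q _ =>
    Submodule.smul_mem _ _ (Submodule.subset_span (Set.mem_range_self _))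

/-- The class sums of `H`-classes commute with the elements of `H`. -/
theorem commute_classSum_single [Fintype G] (H : Subgroup G) (a h : G) (hh : h ∈ H) :
    Commute (classSum (hClassSetoid H) a) (MonoidAlgebra.single h (1 : ℂ)) := by
  classical
  have key : ∀ y : G, hClassSetoid H a (y * h⁻¹) ↔ hClassSetoid H a (h⁻¹ * y) := by
    intro y
    have h1 : hClassSetoid H (y * h⁻¹) (h⁻¹ * y) := ⟨h, hh, by group⟩
    exact ⟨fun h2 => (hClassSetoid H).trans h2 h1,
      fun h2 => (hClassSetoid H).trans h2 ((hClassSetoid H).symm h1)⟩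
  ext y
  simp [MonoidAlgebra.coeff_mul_single_apply, MonoidAlgebra.coeff_single_mul_apply,
    coeff_classSum, key]

variable [Fintype G]

/-- The Schur ring `ℂ[G]^H` of `H`-classes of a finite group `G`. -/
def hClassSchurRing (H : Subgroup G) : SchurRing G where
  rel := hClassSetoid H
  one_singleton := by
    rintro x ⟨h, _, rfl⟩
    simp
  inv_rel := by
    rintro x y ⟨h, hh, rfl⟩
    exact ⟨h, hh, by group⟩
  mul_mem_span := by
    intro a b
    apply mem_span_classSum
    rintro x y ⟨h, hh, rfl⟩
    have hc := (commute_classSum_single H a h hh).mul_left (commute_classSum_single H b h hh)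
    have h1 := congrArg (fun f : MonoidAlgebra ℂ G => f.coeff (x * h)) hc.eq
    rw [MonoidAlgebra.coeff_mul_single_apply, MonoidAlgebra.coeff_single_mul_apply,
      mul_one, one_mul, mul_inv_cancel_right, ← mul_assoc] at h1
    exact h1

/-- `(G, H)` is a strong Gelfand pair: the `H`-classes form a commutative Schur ring. -/
def IsStrongGelfandPair (H : Subgroup G) : Prop :=
  (hClassSchurRing H).IsCommutative

/-- The Terwilliger algebra `T(G, ℂ[G]^H)`, with base point `1`. -/
noncomputable def terwilligerPair [DecidableEq G] (H : Subgroup G) :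
    Subalgebra ℂ (Matrix G G ℂ) :=
  (hClassSchurRing H).terwilligerAlgebra

end HClasses

/-- The Terwilliger algebra `T(G)` of the group association scheme `ℂ[G]^G`, with base
point `1`. -/
noncomputable def terwilligerGroup (G : Type*) [Group G] [Fintype G] [DecidableEq G] :
    Subalgebra ℂ (Matrix G G ℂ) :=
  terwilligerPair (⊤ : Subgroup G)

/-- `N` is a Frobenius kernel of `G` (so that `G` is a Frobenius group): a nontrivial proper normal
subgroup with `C_G(x) ≤ N` for every `1 ≠ x ∈ N`. -/
structure IsFrobeniusKernel {G : Type*} [Group G] (N : Subgroup G) : Prop where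
  normal : N.Normal
  ne_bot : N ≠ ⊥
  ne_top : N ≠ ⊤
  centralizer_le : ∀ x ∈ N, x ≠ 1 → Subgroup.centralizer {x} ≤ N

/-! ### Matrices that lie in the Terwilliger algebra of any Schur ring -/

namespace SchurRing

variable {G : Type*} [Group G] [Fintype G]

/-! For `g ∉ H` the map `h ↦ g⁻¹ h⁻¹ g h` on `H` is injective: a collision gives a nontrivial
element of `H` centralized by `g`, which forces `g ∈ H`. By finiteness it is onto, so every coset
`gH ≠ H` is one `H`-class. The Schur ring is thus a wreath product: conjugacy classes of `H` inside
`H`, whole cosets outside. Class sums from `H` commute with all class sums, and coset sums commute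
because `G/H`, an image of the cyclic complement, is abelian. This gives the strong Gelfand
property.

For the dimension, the algebra is determined entrywise. Upper bound (`isWreathMatrix_of_mem`): the
generators satisfy four conditions that are stable under products. Their `H × H` block lies in
`T(H)`; elsewhere, entries depend only on a label, namely the coset and the class of `y x⁻¹` when
`x`, `y` share a coset, and the two classes otherwise. Lower bound (`wreathMatrix_mem`): zero-padded
elements of `T(H)` and all label indicators belong to the algebra. Hence the dimension is `dim T(H)`
plus the number of labels. With `k - 1` outer cosets and `m` inner classes there are `(k-1)m` labels
within outer cosets, `2m(k-1)` between `H` and outer cosets, and `(k-1)(k-2)` between distinct outer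
cosets. -/

open scoped Classical in
theorem adjMatrix_apply (S : SchurRing G) (g x y : G) :
    S.adjMatrix g x y = if S.rel g (y * x⁻¹) then 1 else 0 := rfl

open scoped Classical in
theorem dualIdempotent_apply (S : SchurRing G) (g x y : G) :
    S.dualIdempotent g x y = if x = y ∧ S.rel g x then 1 else 0 := by
  by_cases hxy : x = y
  · subst hxy
    simp [dualIdempotent, adjMatrix_apply]
  · simp [dualIdempotent, hxy]

open scoped Classical in
theorem dualIdempotent_mul_mul_apply (S : SchurRing G) (g g' : G) (M : Matrix G G ℂ) (x y : G) :
    (S.dualIdempotent g * M * S.dualIdempotent g') x y =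
      if S.rel g x ∧ S.rel g' y then M x y else 0 := by
  rw [dualIdempotent, dualIdempotent, Matrix.mul_diagonal, Matrix.diagonal_mul]
  by_cases h : S.rel g x <;> by_cases h' : S.rel g' y <;> simp [adjMatrix_apply, h, h']

theorem rel_out_iff (S : SchurRing G) (c : Quotient S.rel) (x : G) :
    S.rel c.out x ↔ c = Quotient.mk S.rel x := by
  rw [← Quotient.eq, Quotient.out_eq]

variable [DecidableEq G]

theorem adjMatrix_mem (S : SchurRing G) (g : G) : S.adjMatrix g ∈ S.terwilligerAlgebra :=
  Algebra.subset_adjoin (Or.inl ⟨g, rfl⟩)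

theorem dualIdempotent_mem (S : SchurRing G) (g : G) :
    S.dualIdempotent g ∈ S.terwilligerAlgebra :=
  Algebra.subset_adjoin (Or.inr ⟨g, rfl⟩)

/-- Diagonal matrices that are constant on the principal sets lie in the Terwilliger algebra. -/
theorem diagonal_mem (S : SchurRing G) (f : G → ℂ) (hf : ∀ x y, S.rel x y → f x = f y) :
    Matrix.diagonal f ∈ S.terwilligerAlgebra := by
  classical
  have h : Matrix.diagonal f =
      ∑ c : Quotient S.rel, f c.out • S.dualIdempotent c.out := by
    ext x y
    rw [Matrix.sum_apply, Finset.sum_eq_single (Quotient.mk S.rel x)]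
    · have h1 : S.rel (Quotient.mk S.rel x).out x := Quotient.mk_out x
      simp [dualIdempotent_apply, h1, hf _ _ h1, Matrix.diagonal_apply]
    · intro c _ hc
      simp [dualIdempotent_apply, rel_out_iff, hc]
    · simp
  rw [h]
  exact Subalgebra.sum_mem _ fun c _ => Subalgebra.smul_mem _ (S.dualIdempotent_mem _) _

theorem allOnes_mem (S : SchurRing G) :
    (Matrix.of fun _ _ => 1 : Matrix G G ℂ) ∈ S.terwilligerAlgebra := by
  classical
  have h : (Matrix.of fun _ _ => 1 : Matrix G G ℂ) =
      ∑ c : Quotient S.rel, S.adjMatrix c.out := by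
    ext x y
    simp [Matrix.sum_apply, adjMatrix_apply, rel_out_iff]
  rw [h]
  exact Subalgebra.sum_mem _ fun c _ => S.adjMatrix_mem _

/-- Matrices that are constant on the products of two principal sets lie in the Terwilliger
algebra. -/
theorem mem_of_const_on_classes (S : SchurRing G) (M : Matrix G G ℂ)
    (hM : ∀ x y x' y', S.rel x x' → S.rel y y' → M x y = M x' y') :
    M ∈ S.terwilligerAlgebra := by
  classical
  -- The summand of `c` copies the row `M c.out` into every row indexed by the class `c` and
  -- vanishes on the other rows.
  have h : M = ∑ c : Quotient S.rel,
      S.dualIdempotent c.out * (Matrix.of fun _ _ => 1) * Matrix.diagonal (M c.out) := by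
    ext x y
    have h1 : S.rel (Quotient.mk S.rel x).out x := Quotient.mk_out x
    rw [Matrix.sum_apply, Finset.sum_eq_single (Quotient.mk S.rel x)]
    · simp [Matrix.mul_apply, Matrix.diagonal_apply, dualIdempotent_apply, h1]
      exact (hM _ _ _ _ h1 (S.rel.refl y)).symm
    · intro c _ hc
      simp [Matrix.mul_apply, dualIdempotent_apply, rel_out_iff, hc]
    · simp
  rw [h]
  exact Subalgebra.sum_mem _ fun c _ => Subalgebra.mul_mem _
    (Subalgebra.mul_mem _ (S.dualIdempotent_mem _) S.allOnes_mem)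
    (S.diagonal_mem _ fun x y hxy => hM _ _ _ _ (S.rel.refl _) hxy)

end SchurRing

/-! ### Upper bound: entrywise conditions satisfied by the whole algebra -/

section WreathStructure

variable {G : Type*} [Group G]

/-- Every coset of `H` other than `H` is contained in a single `H`-class. -/
def CosetsAreClasses (H : Subgroup G) : Prop :=
  ∀ g x : G, g ∉ H → (g : G ⧸ H) = x → hClassSetoid H g x

theorem hClassSetoid_mem_iff {H : Subgroup G} {x y : G} (h : hClassSetoid H x y) :
    x ∈ H ↔ y ∈ H := by
  obtain ⟨h, hh, rfl⟩ := h
  rw [H.mul_mem_cancel_right hh, H.mul_mem_cancel_left (H.inv_mem hh)]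

theorem hClassSetoid_conj (H : Subgroup G) {h : G} (hh : h ∈ H) (x : G) :
    hClassSetoid H x (h⁻¹ * x * h) := ⟨h, hh, rfl⟩

theorem hClassSetoid_coset_eq {H : Subgroup G} [H.Normal] {x y : G} (h : hClassSetoid H x y) :
    (x : G ⧸ H) = y := by
  obtain ⟨h, hh, rfl⟩ := h
  have := (QuotientGroup.eq_one_iff h).2 hh
  simp [this]

theorem hClassSetoid_iff_coset_eq {H : Subgroup G} [H.Normal] (hcl : CosetsAreClasses H)
    {g x : G} (hg : g ∉ H) : hClassSetoid H g x ↔ (g : G ⧸ H) = x :=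
  ⟨hClassSetoid_coset_eq, hcl g x hg⟩

theorem mem_iff_of_coset_eq {H : Subgroup G} [H.Normal] {x y : G} (h : (x : G ⧸ H) = y) :
    x ∈ H ↔ y ∈ H := by
  rw [← QuotientGroup.eq_one_iff, ← QuotientGroup.eq_one_iff, h]

theorem coset_eq_iff_div_mem {H : Subgroup G} [H.Normal] {x y : G} :
    (x : G ⧸ H) = y ↔ y * x⁻¹ ∈ H := by
  rw [← QuotientGroup.eq_one_iff, QuotientGroup.mk_mul, QuotientGroup.mk_inv, mul_inv_eq_one,
    eq_comm]

open scoped Classical in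
/-- The permutation of `G` that fixes `H` pointwise and is right multiplication by `l ∈ H` on the
other cosets. -/
noncomputable def offKernelShift (H : Subgroup G) (l : H) : Equiv.Perm G where
  toFun x := if x ∈ H then x else x * l
  invFun x := if x ∈ H then x else x * (l : G)⁻¹
  left_inv x := by
    by_cases hx : x ∈ H <;> simp [hx, H.mul_mem_cancel_right l.2]
  right_inv x := by
    by_cases hx : x ∈ H <;> simp [hx, H.mul_mem_cancel_right (H.inv_mem l.2)]

theorem offKernelShift_of_mem {H : Subgroup G} (l : H) {x : G} (hx : x ∈ H) :
    offKernelShift H l x = x := if_pos hx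

theorem offKernelShift_of_notMem {H : Subgroup G} (l : H) {x : G} (hx : x ∉ H) :
    offKernelShift H l x = x * l := if_neg hx

theorem offKernelShift_mem_iff {H : Subgroup G} (l : H) (x : G) :
    offKernelShift H l x ∈ H ↔ x ∈ H := by
  by_cases hx : x ∈ H
  · rw [offKernelShift_of_mem l hx]
  · rw [offKernelShift_of_notMem l hx, H.mul_mem_cancel_right l.2]

theorem coset_offKernelShift {H : Subgroup G} [H.Normal] (l : H) (x : G) :
    (offKernelShift H l x : G ⧸ H) = x := by
  by_cases hx : x ∈ H
  · rw [offKernelShift_of_mem l hx]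
  · rw [offKernelShift_of_notMem l hx]
    simp

theorem hClassSetoid_coe {H : Subgroup G} {a b : H} (h : hClassSetoid (⊤ : Subgroup H) a b) :
    hClassSetoid H (a : G) b := by
  obtain ⟨c, -, rfl⟩ := h
  exact ⟨c, c.2, by simp⟩

theorem hClassSetoid_coe_iff {H : Subgroup G} {a b : H} :
    hClassSetoid H (a : G) b ↔ hClassSetoid (⊤ : Subgroup H) a b := by
  refine ⟨?_, hClassSetoid_coe⟩
  rintro ⟨h, hh, hab⟩
  exact ⟨⟨h, hh⟩, trivial, Subtype.ext (by simpa using hab)⟩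

/-- For `x`, `y` in different cosets, the entry at `(x, y)` depends only on the `H`-classes of `x`
and `y`. -/
def ConstBetweenCosets (H : Subgroup G) (M : Matrix G G ℂ) : Prop :=
  ∀ x y x' y' : G, (x : G ⧸ H) ≠ y → hClassSetoid H x x' → hClassSetoid H y y' →
    M x y = M x' y'

/-- The entrywise conditions that describe the matrices of `terwilligerPair H`. -/
structure IsWreathMatrix (H : Subgroup G) [Fintype H] [DecidableEq H] (M : Matrix G G ℂ) :
    Prop where
  conj : ∀ h ∈ H, ∀ x y, M (h⁻¹ * x * h) (h⁻¹ * y * h) = M x y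
  shift : ∀ l x y, M (offKernelShift H l x) (offKernelShift H l y) = M x y
  const : ConstBetweenCosets H M
  block : (M.submatrix (fun a : H => (a : G)) (fun a : H => (a : G))) ∈ terwilligerGroup H

theorem isWreathMatrix_diagonal {H : Subgroup G} [H.Normal] [Fintype H] [DecidableEq H]
    [DecidableEq G] (hcl : CosetsAreClasses H) (f : G → ℂ)
    (hf : ∀ x y, hClassSetoid H x y → f x = f y) : IsWreathMatrix H (Matrix.diagonal f) where
  conj h hh x y := by
    simp [Matrix.diagonal_apply, hf _ _ (hClassSetoid_conj H hh x)]
  shift l x y := by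
    have : f (offKernelShift H l x) = f x := by
      by_cases hx : x ∈ H
      · rw [offKernelShift_of_mem l hx]
      · exact (hf _ _ (hcl _ _ hx (coset_offKernelShift l x).symm)).symm
    simp [Matrix.diagonal_apply, this]
  const x y x' y' hxy hx hy := by
    have h1 : x ≠ y := fun h => hxy (by rw [h])
    have h2 : x' ≠ y' := fun h => hxy (by
      rw [hClassSetoid_coset_eq hx, hClassSetoid_coset_eq hy, h])
    simp [h1, h2]
  block := by
    have h : (Matrix.diagonal f).submatrix (fun a : H => (a : G)) (fun a : H => (a : G)) =
        Matrix.diagonal fun a : H => f a := by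
      ext a b
      simp [Matrix.diagonal_apply]
    rw [h]
    exact SchurRing.diagonal_mem _ _ fun x y hxy => hf _ _ (hClassSetoid_coe hxy)

theorem IsWreathMatrix.add {H : Subgroup G} [Fintype H] [DecidableEq H]
    {M N : Matrix G G ℂ} (hM : IsWreathMatrix H M) (hN : IsWreathMatrix H N) :
    IsWreathMatrix H (M + N) where
  conj h hh x y := by simp [hM.conj h hh, hN.conj h hh]
  shift l x y := by simp [hM.shift l, hN.shift l]
  const x y x' y' hxy hx hy := by
    simp [hM.const x y x' y' hxy hx hy, hN.const x y x' y' hxy hx hy]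
  block := add_mem hM.block hN.block

variable [Fintype G]

/-- A matrix product of matrices that are invariant under a permutation is invariant. -/
theorem mul_apply_perm {X : Type*} [Fintype X] (σ : Equiv.Perm X) {M N : Matrix X X ℂ}
    (hM : ∀ x y, M (σ x) (σ y) = M x y) (hN : ∀ x y, N (σ x) (σ y) = N x y) (x y : X) :
    (M * N) (σ x) (σ y) = (M * N) x y := by
  simp only [Matrix.mul_apply]
  rw [← Equiv.sum_comp σ]
  simp [hM, hN]

/-- Matrices invariant under conjugation by `H` preserve the functions constant on `H`-classes. -/
theorem sum_mul_const_on_classes {H : Subgroup G} {M : Matrix G G ℂ}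
    (hM : ∀ h ∈ H, ∀ x y, M (h⁻¹ * x * h) (h⁻¹ * y * h) = M x y) {v : G → ℂ}
    (hv : ∀ x y, hClassSetoid H x y → v x = v y) {x x' : G} (hx : hClassSetoid H x x') :
    ∑ z, M x z * v z = ∑ z, M x' z * v z := by
  obtain ⟨h, hh, rfl⟩ := hx
  have e := Equiv.sum_comp ((MulAut.conj h⁻¹).toEquiv) (fun z => M (h⁻¹ * x * h) z * v z)
  rw [← e]
  refine Finset.sum_congr rfl fun z _ => ?_
  have h1 : (MulAut.conj h⁻¹).toEquiv z = h⁻¹ * z * h := by simp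
  rw [h1, hM h hh, hv _ _ (hClassSetoid_conj H hh z)]

/-- Split the sum over `z` by whether `z` lies in the coset of `x`. If it does, `N z y` is a class
function of `z`, and the conjugation-invariant `M` preserves class functions; if not, `M x z` itself
depends only on the class of `x`. -/
theorem mul_apply_eq_of_class_left {H : Subgroup G} [H.Normal] {M N : Matrix G G ℂ}
    (hM : ∀ h ∈ H, ∀ x y, M (h⁻¹ * x * h) (h⁻¹ * y * h) = M x y)
    (hMc : ConstBetweenCosets H M)
    (hNc : ConstBetweenCosets H N) {x x' y : G} (hxy : (x : G ⧸ H) ≠ y) (hx : hClassSetoid H x x') :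
    (M * N) x y = (M * N) x' y := by
  classical
  have key : ∀ w : G, (w : G ⧸ H) = x → (M * N) w y =
      (∑ z, M w z * (if (z : G ⧸ H) = x then N z y else 0)) +
        ∑ z : G, if (z : G ⧸ H) = x then 0 else M w z * N z y := by
    intro w _
    rw [Matrix.mul_apply, ← Finset.sum_add_distrib]
    refine Finset.sum_congr rfl fun z _ => ?_
    split_ifs <;> simp
  rw [key x rfl, key x' (hClassSetoid_coset_eq hx).symm]
  congr 1
  · refine sum_mul_const_on_classes hM (fun z z' hz => ?_) hx
    rw [← hClassSetoid_coset_eq hz]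
    split_ifs with hzx
    · exact hNc _ _ _ _ (hzx ▸ hxy) hz ((hClassSetoid H).refl y)
    · rfl
  · refine Finset.sum_congr rfl fun z _ => ?_
    split_ifs with hzx
    · rfl
    · rw [hMc x z x' z (Ne.symm hzx) hx ((hClassSetoid H).refl z)]

theorem IsWreathMatrix.mul {H : Subgroup G} [H.Normal] [Fintype H] [DecidableEq H]
    {M N : Matrix G G ℂ} (hM : IsWreathMatrix H M) (hN : IsWreathMatrix H N) :
    IsWreathMatrix H (M * N) where
  conj h hh x y := by
    have := mul_apply_perm (MulAut.conj h⁻¹).toEquiv (M := M) (N := N)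
      (fun x y => by simpa using hM.conj h hh x y) (fun x y => by simpa using hN.conj h hh x y) x y
    simpa using this
  shift l := mul_apply_perm _ (hM.shift l) (hN.shift l)
  const x y x' y' hxy hx hy := by
    have hx'y : (x' : G ⧸ H) ≠ y := hClassSetoid_coset_eq hx ▸ hxy
    rw [mul_apply_eq_of_class_left hM.conj hM.const hN.const hxy hx]
    -- The hypotheses are symmetric under transposition, so dependence on the column follows from
    -- dependence on the row.
    have := mul_apply_eq_of_class_left (M := N.transpose) (N := M.transpose) (x := y) (x' := y')
      (y := x') (fun h hh a b => hN.conj h hh b a)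
      (fun a b a' b' hab ha hb => hN.const b a b' a' hab.symm hb ha)
      (fun a b a' b' hab ha hb => hM.const b a b' a' hab.symm hb ha) hx'y.symm hy
    rw [← Matrix.transpose_mul] at this
    exact this
  block := by
    classical
    -- Paths through `H` give the product of the blocks. Paths through `z ∉ H` give a matrix
    -- constant on products of classes, and such matrices already lie in `T(H)`.
    have h : (M * N).submatrix (fun a : H => (a : G)) (fun a : H => (a : G)) =
        M.submatrix (fun a : H => (a : G)) (fun a : H => (a : G)) *
          N.submatrix (fun a : H => (a : G)) (fun a : H => (a : G)) +
        Matrix.of fun a b : H => ∑ z : {z : G // z ∉ H}, M a z * N z b := by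
      ext a b
      simp only [Matrix.submatrix_apply, Matrix.mul_apply, Matrix.add_apply, Matrix.of_apply]
      rw [← Fintype.sum_subtype_add_sum_subtype (fun z => z ∈ H) (fun z => M a z * N z b)]
      congr!
    rw [h]
    refine add_mem (mul_mem hM.block hN.block) (SchurRing.mem_of_const_on_classes _ _ ?_)
    intro a b a' b' ha hb
    have hne : ∀ c : H, ∀ z : {z : G // z ∉ H}, (c : G ⧸ H) ≠ (z : G) := fun c z hc =>
      z.2 ((mem_iff_of_coset_eq hc).1 c.2)
    refine Finset.sum_congr rfl fun z _ => ?_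
    rw [hM.const a z a' z (hne a z) (hClassSetoid_coe ha) ((hClassSetoid H).refl _),
      hN.const z b z b' (hne b z).symm ((hClassSetoid H).refl _) (hClassSetoid_coe hb)]

theorem submatrix_adjMatrix_of_mem {H : Subgroup G} [Fintype H] (g : H) :
    ((hClassSchurRing H).adjMatrix g).submatrix (fun a : H => (a : G)) (fun a : H => (a : G)) =
      (hClassSchurRing (⊤ : Subgroup H)).adjMatrix g := by
  classical
  ext a b
  simp only [Matrix.submatrix_apply, SchurRing.adjMatrix_apply]
  exact if_congr (by exact_mod_cast hClassSetoid_coe_iff (a := g) (b := b * a⁻¹)) rfl rfl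

theorem submatrix_dualIdempotent_of_mem {H : Subgroup G} [Fintype H] (g : H) :
    ((hClassSchurRing H).dualIdempotent g).submatrix (fun a : H => (a : G))
      (fun a : H => (a : G)) = (hClassSchurRing (⊤ : Subgroup H)).dualIdempotent g := by
  classical
  ext a b
  simp only [Matrix.submatrix_apply, SchurRing.dualIdempotent_apply]
  congr 1
  exact propext (and_congr Subtype.ext_iff.symm hClassSetoid_coe_iff)

theorem isWreathMatrix_adjMatrix {H : Subgroup G} [H.Normal] [Fintype H] [DecidableEq H]
    (hcl : CosetsAreClasses H) (g : G) : IsWreathMatrix H ((hClassSchurRing H).adjMatrix g) where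
  conj h hh x y := by
    classical
    simp only [SchurRing.adjMatrix_apply]
    refine if_congr ?_ rfl rfl
    have h1 : h⁻¹ * y * h * (h⁻¹ * x * h)⁻¹ = h⁻¹ * (y * x⁻¹) * h := by group
    rw [h1]
    have h2 := hClassSetoid_conj H hh (y * x⁻¹)
    exact ⟨fun h3 => (hClassSetoid H).trans h3 ((hClassSetoid H).symm h2),
      fun h3 => (hClassSetoid H).trans h3 h2⟩
  shift l x y := by
    classical
    simp only [SchurRing.adjMatrix_apply]
    refine if_congr ?_ rfl rfl
    change hClassSetoid H g _ ↔ hClassSetoid H g _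
    -- For `g ∈ H` only pairs in one coset matter, where the shift is trivial or a right
    -- multiplication, and so keeps `y x⁻¹`. For `g ∉ H` the entry sees only cosets, which the shift
    -- preserves.
    by_cases hg : g ∈ H
    · by_cases hx : x ∈ H <;> by_cases hy : y ∈ H
      · rw [offKernelShift_of_mem l hx, offKernelShift_of_mem l hy]
      · have h1 : y * x⁻¹ ∉ H := by rwa [H.mul_mem_cancel_right (H.inv_mem hx)]
        have h2 : offKernelShift H l y * (offKernelShift H l x)⁻¹ ∉ H := by
          rwa [H.mul_mem_cancel_right (H.inv_mem ((offKernelShift_mem_iff l x).2 hx)),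
            offKernelShift_mem_iff]
        exact iff_of_false (fun h => h2 ((hClassSetoid_mem_iff h).1 hg))
          (fun h => h1 ((hClassSetoid_mem_iff h).1 hg))
      · have h1 : y * x⁻¹ ∉ H := by rwa [H.mul_mem_cancel_left hy, inv_mem_iff]
        have h2 : offKernelShift H l y * (offKernelShift H l x)⁻¹ ∉ H := by
          rwa [H.mul_mem_cancel_left ((offKernelShift_mem_iff l y).2 hy), inv_mem_iff,
            offKernelShift_mem_iff]
        exact iff_of_false (fun h => h2 ((hClassSetoid_mem_iff h).1 hg))
          (fun h => h1 ((hClassSetoid_mem_iff h).1 hg))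
      · rw [offKernelShift_of_notMem l hx, offKernelShift_of_notMem l hy]
        have h1 : y * l * (x * l)⁻¹ = y * x⁻¹ := by group
        rw [h1]
    · rw [hClassSetoid_iff_coset_eq hcl hg, hClassSetoid_iff_coset_eq hcl hg]
      simp only [QuotientGroup.mk_mul, QuotientGroup.mk_inv, coset_offKernelShift]
  const x y x' y' hxy hx hy := by
    classical
    simp only [SchurRing.adjMatrix_apply]
    refine if_congr ?_ rfl rfl
    change hClassSetoid H g _ ↔ hClassSetoid H g _
    -- Between different cosets `y x⁻¹ ∉ H`, so the entries vanish for `g ∈ H`; for `g ∉ H` they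
    -- depend on the cosets alone.
    by_cases hg : g ∈ H
    · have h1 : y * x⁻¹ ∉ H := fun h => hxy (coset_eq_iff_div_mem.2 h)
      have h2 : y' * x'⁻¹ ∉ H := fun h => hxy (by
        rw [hClassSetoid_coset_eq hx, hClassSetoid_coset_eq hy]
        exact coset_eq_iff_div_mem.2 h)
      exact iff_of_false (fun h => h1 ((hClassSetoid_mem_iff h).1 hg))
          (fun h => h2 ((hClassSetoid_mem_iff h).1 hg))
    · rw [hClassSetoid_iff_coset_eq hcl hg, hClassSetoid_iff_coset_eq hcl hg]
      simp only [QuotientGroup.mk_mul, QuotientGroup.mk_inv, hClassSetoid_coset_eq hx,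
        hClassSetoid_coset_eq hy]
  block := by
    by_cases hg : g ∈ H
    · rw [submatrix_adjMatrix_of_mem ⟨g, hg⟩]
      exact SchurRing.adjMatrix_mem _ _
    · convert Subalgebra.zero_mem (terwilligerGroup H)
      ext a b
      have h1 : ¬ (hClassSchurRing H).rel g ((b : G) * (a : G)⁻¹) := fun h =>
        hg ((hClassSetoid_mem_iff h).2 (H.mul_mem b.2 (H.inv_mem a.2)))
      simp [SchurRing.adjMatrix_apply, h1]

theorem isWreathMatrix_of_mem {H : Subgroup G} [H.Normal] [Fintype H] [DecidableEq H]
    [DecidableEq G] (hcl : CosetsAreClasses H) {M : Matrix G G ℂ} (hM : M ∈ terwilligerPair H) :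
    IsWreathMatrix H M := by
  classical
  induction hM using Algebra.adjoin_induction with
  | mem M h =>
    rcases h with ⟨g, rfl⟩ | ⟨g, rfl⟩
    · exact isWreathMatrix_adjMatrix hcl g
    · convert isWreathMatrix_diagonal hcl (fun y => (hClassSchurRing H).adjMatrix g 1 y) ?_ using 1
      · unfold SchurRing.dualIdempotent
        congr!
      intro x y hxy
      simp only [SchurRing.adjMatrix_apply, inv_one, mul_one]
      exact if_congr ⟨fun h => (hClassSetoid H).trans h hxy,
        fun h => (hClassSetoid H).trans h ((hClassSetoid H).symm hxy)⟩ rfl rfl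
  | algebraMap r =>
    rw [Matrix.algebraMap_eq_diagonal]
    exact isWreathMatrix_diagonal hcl _ fun _ _ _ => rfl
  | add M N _ _ hM hN => exact hM.add hN
  | mul M N _ _ hM hN => exact hM.mul hN

end WreathStructure

/-! ### Labels of pairs and the dimension count -/

section Dimension

variable {G : Type*} [Group G]

theorem hClassSetoid_mk_eq_iff {H : Subgroup G} {x y : G} :
    Quotient.mk (hClassSetoid H) x = Quotient.mk (hClassSetoid H) y ↔ hClassSetoid H x y :=
  Quotient.eq

open scoped Classical in
/-- The label of a pair of elements of `G`: the coset and the class of `y x⁻¹` for two elements of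
one coset, the two classes otherwise. -/
noncomputable def pairLabel (H : Subgroup G) (x y : G) :
    (Quotient (hClassSetoid H) × Quotient (hClassSetoid H)) ⊕
      (Quotient (hClassSetoid H) × Quotient (hClassSetoid H)) :=
  if (x : G ⧸ H) = y then Sum.inl (Quotient.mk _ x, Quotient.mk _ (y * x⁻¹))
  else Sum.inr (Quotient.mk _ x, Quotient.mk _ y)

/-- Matrices satisfying the entrywise conditions are constant on the pairs with a given label. -/
theorem IsWreathMatrix.eq_of_pairLabel {H : Subgroup G} [H.Normal] [Fintype H] [DecidableEq H]
    {M : Matrix G G ℂ} (hM : IsWreathMatrix H M) {x y x' y' : G} (hxy : ¬ (x ∈ H ∧ y ∈ H))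
    (h : pairLabel H x y = pairLabel H x' y') : M x y = M x' y' := by
  classical
  unfold pairLabel at h
  split_ifs at h with h1 h2 h2
  · simp only [Sum.inl.injEq, Prod.mk.injEq, hClassSetoid_mk_eq_iff] at h
    obtain ⟨hx, c, hc, hcy⟩ := h
    have hxH : x ∉ H := fun hx' => hxy ⟨hx', (mem_iff_of_coset_eq h1).1 hx'⟩
    have hyH : y ∉ H := (mem_iff_of_coset_eq h1).not.1 hxH
    have hx1 : c⁻¹ * x * c ∉ H := (hClassSetoid_mem_iff (hClassSetoid_conj H hc x)).not.1 hxH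
    have hy1 : c⁻¹ * y * c ∉ H := (hClassSetoid_mem_iff (hClassSetoid_conj H hc y)).not.1 hyH
    have hl : (c⁻¹ * x * c)⁻¹ * x' ∈ H := by
      -- Conjugation by `c` turns `y x⁻¹` into `y' x'⁻¹`; right multiplication by this element of
      -- `H` then carries the conjugated pair to `(x', y')`.
      rw [← QuotientGroup.eq, ← hClassSetoid_coset_eq hx]
      exact (hClassSetoid_coset_eq (hClassSetoid_conj H hc x)).symm
    have key := hM.shift ⟨_, hl⟩ (c⁻¹ * x * c) (c⁻¹ * y * c)
    rw [offKernelShift_of_notMem _ hx1, offKernelShift_of_notMem _ hy1, hM.conj c hc] at key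
    rw [← key]
    congr 1
    · group
    · have : y' = y' * x'⁻¹ * x' := by group
      rw [this, ← hcy]
      group
  · simp only [Sum.inr.injEq, Prod.mk.injEq, hClassSetoid_mk_eq_iff] at h
    exact hM.const x y x' y' h1 h.1 h.2

section Labels

variable [Fintype G]

open scoped Classical in
/-- The `H`-classes contained in `H`. -/
noncomputable def innerClasses (H : Subgroup G) : Finset (Quotient (hClassSetoid H)) :=
  Finset.univ.filter fun c => ∃ x ∈ H, Quotient.mk _ x = c

open scoped Classical in
/-- The `H`-classes outside `H`. -/
noncomputable def outerClasses (H : Subgroup G) : Finset (Quotient (hClassSetoid H)) :=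
  Finset.univ.filter fun c => ∃ x ∉ H, Quotient.mk _ x = c

theorem mk_mem_innerClasses {H : Subgroup G} {x : G} :
    Quotient.mk _ x ∈ innerClasses H ↔ x ∈ H := by
  simp only [innerClasses, Finset.mem_filter, Finset.mem_univ, true_and, hClassSetoid_mk_eq_iff]
  exact ⟨fun ⟨y, hy, h⟩ => (hClassSetoid_mem_iff h).1 hy,
    fun h => ⟨x, h, (hClassSetoid H).refl x⟩⟩

theorem mk_mem_outerClasses {H : Subgroup G} {x : G} :
    Quotient.mk _ x ∈ outerClasses H ↔ x ∉ H := by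
  simp only [outerClasses, Finset.mem_filter, Finset.mem_univ, true_and, hClassSetoid_mk_eq_iff]
  exact ⟨fun ⟨y, hy, h⟩ => (hClassSetoid_mem_iff h).not.1 hy,
    fun h => ⟨x, h, (hClassSetoid H).refl x⟩⟩

open scoped Classical in
/-- The labels of the pairs of elements of `G` that do not both lie in `H`. -/
noncomputable def outerLabels (H : Subgroup G) :
    Finset ((Quotient (hClassSetoid H) × Quotient (hClassSetoid H)) ⊕
      (Quotient (hClassSetoid H) × Quotient (hClassSetoid H))) :=
  -- Within an outer coset the first component is that coset and the second the class of `y x⁻¹ ∈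
  -- H`. The diagonal is removed from the pairs of outer classes since equal classes mean equal
  -- cosets.
  (outerClasses H ×ˢ innerClasses H).disjSum
    ((innerClasses H ×ˢ outerClasses H ∪ outerClasses H ×ˢ innerClasses H) ∪
      (outerClasses H).offDiag)

theorem card_outerLabels (H : Subgroup G) :
    (outerLabels H).card = 3 * ((innerClasses H).card * (outerClasses H).card) +
      ((outerClasses H).card * (outerClasses H).card - (outerClasses H).card) := by
  classical
  have hd : Disjoint (innerClasses H) (outerClasses H) := by
    rw [Finset.disjoint_left]
    intro c
    induction c using Quotient.inductionOn with | _ x => ?_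
    rw [mk_mem_innerClasses, mk_mem_outerClasses]
    exact not_not_intro
  rw [outerLabels, Finset.card_disjSum, Finset.card_union_of_disjoint,
    Finset.card_union_of_disjoint, Finset.offDiag_card]
  · simp only [Finset.card_product]
    ring_nf
  · exact Finset.disjoint_product.2 (Or.inl hd)
  · rw [Finset.disjoint_left]
    rintro ⟨a, b⟩ hab h
    rw [Finset.mem_offDiag] at h
    rcases Finset.mem_union.1 hab with h1 | h1 <;> rw [Finset.mem_product] at h1
    · exact Finset.disjoint_left.1 hd h1.1 h.1
    · exact Finset.disjoint_left.1 hd h1.2 h.2.1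

theorem pairLabel_mem_outerLabels {H : Subgroup G} [H.Normal] (x y : G) :
    pairLabel H x y ∈ outerLabels H ↔ ¬ (x ∈ H ∧ y ∈ H) := by
  classical
  unfold pairLabel
  split_ifs with h
  · simp only [outerLabels, Finset.inl_mem_disjSum, Finset.mem_product, mk_mem_outerClasses,
      mk_mem_innerClasses, coset_eq_iff_div_mem.1 h, and_true, ← mem_iff_of_coset_eq h, and_self]
  · simp only [outerLabels, Finset.inr_mem_disjSum, Finset.mem_union, Finset.mem_product,
      Finset.mem_offDiag, mk_mem_outerClasses, mk_mem_innerClasses]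
    have h1 : Quotient.mk (hClassSetoid H) x ≠ Quotient.mk (hClassSetoid H) y := fun e =>
      h (hClassSetoid_coset_eq (hClassSetoid_mk_eq_iff.1 e))
    tauto

theorem exists_pairLabel_eq {H : Subgroup G} [H.Normal] (hcl : CosetsAreClasses H) {i}
    (hi : i ∈ outerLabels H) : ∃ x y, pairLabel H x y = i := by
  classical
  rcases i with ⟨a, b⟩ | ⟨a, b⟩ <;> induction a using Quotient.inductionOn with | _ x => ?_ <;>
    induction b using Quotient.inductionOn with | _ y => ?_
  · simp only [outerLabels, Finset.inl_mem_disjSum, Finset.mem_product, mk_mem_outerClasses,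
      mk_mem_innerClasses] at hi
    refine ⟨x, y * x, ?_⟩
    rw [pairLabel, if_pos (coset_eq_iff_div_mem.2 (by simpa using hi.2)), mul_inv_cancel_right]
  · refine ⟨x, y, if_neg fun h => ?_⟩
    have h1 := mem_iff_of_coset_eq h
    simp only [outerLabels, Finset.inr_mem_disjSum, Finset.mem_union, Finset.mem_product,
      Finset.mem_offDiag, mk_mem_outerClasses, mk_mem_innerClasses, ne_eq,
      hClassSetoid_mk_eq_iff] at hi
    have h2 := hcl x y
    tauto

end Labels

/-! ### Lower bound: padded blocks and label indicators -/

/-- The zero-padded extension of an `H × H` matrix to a `G × G` matrix. -/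
noncomputable def inclusionMatrix (H : Subgroup G) [DecidableEq G] : Matrix G H ℂ :=
  Matrix.of fun g h => if g = h then 1 else 0

variable [DecidableEq G]

theorem inclusionMatrix_conj_of_mem (H : Subgroup G) [Fintype H] (t : Matrix H H ℂ) (x y : H) :
    (inclusionMatrix H * t * (inclusionMatrix H).transpose) x y = t x y := by
  simp [Matrix.mul_apply, inclusionMatrix]

theorem inclusionMatrix_conj_of_notMem (H : Subgroup G) [Fintype H] (t : Matrix H H ℂ) {x y : G}
    (hxy : ¬ (x ∈ H ∧ y ∈ H)) :
    (inclusionMatrix H * t * (inclusionMatrix H).transpose) x y = 0 := by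
  simp only [Matrix.mul_apply, inclusionMatrix, Matrix.transpose_apply, Matrix.of_apply]
  by_cases hy : y ∈ H
  · have hx : ∀ h : H, x ≠ h := fun h e => hxy ⟨e ▸ h.2, hy⟩
    simp [hx]
  · have hy' : ∀ h : H, y ≠ h := fun h e => hy (e ▸ h.2)
    simp [hy']

variable [Fintype G]

theorem inclusionMatrix_conj_mul (H : Subgroup G) [Fintype H] (s t : Matrix H H ℂ) :
    inclusionMatrix H * (s * t) * (inclusionMatrix H).transpose =
      (inclusionMatrix H * s * (inclusionMatrix H).transpose) *
        (inclusionMatrix H * t * (inclusionMatrix H).transpose) := by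
  have h : (inclusionMatrix H).transpose * inclusionMatrix H = 1 := by
    ext a b
    by_cases hab : a = b
    · subst hab
      simp [Matrix.mul_apply, inclusionMatrix]
    · have hab' : (b : G) ≠ a := fun e => hab (Subtype.ext e.symm)
      simp [Matrix.mul_apply, inclusionMatrix, hab, hab']
  calc _ = inclusionMatrix H * s * ((inclusionMatrix H).transpose * inclusionMatrix H) * t *
        (inclusionMatrix H).transpose := by simp only [h, Matrix.mul_one, Matrix.mul_assoc]
    _ = _ := by simp only [Matrix.mul_assoc]

open scoped Classical in
theorem kernelProjection_mem (H : Subgroup G) :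
    (Matrix.diagonal fun x => if x ∈ H then (1 : ℂ) else 0) ∈ terwilligerPair H :=
  SchurRing.diagonal_mem _ _ fun _ _ hxy => if_congr (hClassSetoid_mem_iff hxy) rfl rfl

-- Restricting to `H` and padding back amounts to cutting with the projection onto `H`. That
-- projection lies in the algebra, so padded blocks of members are members.
open scoped Classical in
theorem inclusionMatrix_conj_submatrix (H : Subgroup G) [Fintype H] (M : Matrix G G ℂ) :
    inclusionMatrix H * M.submatrix (fun a : H => (a : G)) (fun a : H => (a : G)) *
        (inclusionMatrix H).transpose =
      (Matrix.diagonal fun x => if x ∈ H then (1 : ℂ) else 0) * M *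
        (Matrix.diagonal fun x => if x ∈ H then (1 : ℂ) else 0) := by
  ext x y
  by_cases hxy : x ∈ H ∧ y ∈ H
  · have := inclusionMatrix_conj_of_mem H
      (M.submatrix (fun a : H => (a : G)) (fun a : H => (a : G))) ⟨x, hxy.1⟩ ⟨y, hxy.2⟩
    simpa [hxy.1, hxy.2] using this
  · rw [inclusionMatrix_conj_of_notMem H _ hxy]
    by_cases hx : x ∈ H
    · have hy : y ∉ H := fun hy => hxy ⟨hx, hy⟩
      simp [hy]
    · simp [hx]

/-- Padding is additive and multiplicative, so generators and scalars suffice. It is not unital,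
hence scalars too are treated as corners of scalars of the larger algebra. -/
theorem inclusionMatrix_conj_mem {H : Subgroup G} [Fintype H] {t : Matrix H H ℂ}
    (ht : t ∈ terwilligerGroup H) :
    inclusionMatrix H * t * (inclusionMatrix H).transpose ∈ terwilligerPair H := by
  classical
  induction ht using Algebra.adjoin_induction with
  | mem t h =>
    rcases h with ⟨g, rfl⟩ | ⟨g, rfl⟩
    · rw [← submatrix_adjMatrix_of_mem, inclusionMatrix_conj_submatrix]
      exact mul_mem (mul_mem (kernelProjection_mem H) (SchurRing.adjMatrix_mem _ _))
        (kernelProjection_mem H)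
    · rw [← submatrix_dualIdempotent_of_mem, inclusionMatrix_conj_submatrix]
      exact mul_mem (mul_mem (kernelProjection_mem H) (SchurRing.dualIdempotent_mem _ _))
        (kernelProjection_mem H)
  | algebraMap r =>
    have h : (algebraMap ℂ (Matrix H H ℂ) r) =
        (algebraMap ℂ (Matrix G G ℂ) r).submatrix (fun a : H => (a : G)) (fun a : H => (a : G)) := by
      ext a b
      simp [Matrix.algebraMap_matrix_apply]
    rw [h, inclusionMatrix_conj_submatrix]
    exact mul_mem (mul_mem (kernelProjection_mem H) (Subalgebra.algebraMap_mem _ r))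
        (kernelProjection_mem H)
  | add s t _ _ hs ht =>
    rw [Matrix.mul_add, Matrix.add_mul]
    exact add_mem hs ht
  | mul s t _ _ hs ht =>
    rw [inclusionMatrix_conj_mul]
    exact mul_mem hs ht

open scoped Classical in
/-- The indicator matrix of the pairs with a given label lies in the Terwilliger algebra. -/
theorem labelIndicator_mem {H : Subgroup G} [H.Normal] (hcl : CosetsAreClasses H) {i}
    (hi : i ∈ outerLabels H) :
    (Matrix.of fun x y => if pairLabel H x y = i then (1 : ℂ) else 0) ∈ terwilligerPair H := by
  obtain ⟨g, g', rfl⟩ := exists_pairLabel_eq hcl hi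
  rw [pairLabel_mem_outerLabels] at hi
  by_cases hg : (g : G ⧸ H) = g'
  · have hgH : g ∉ H := fun h => hi ⟨h, (mem_iff_of_coset_eq hg).1 h⟩
    -- The class of `g` is all of `gH`, so the two idempotents confine both indices to this coset
    -- and the adjacency matrix selects the class of `y x⁻¹`.
    have h : (Matrix.of fun x y => if pairLabel H x y = pairLabel H g g' then (1 : ℂ) else 0) =
        (hClassSchurRing H).dualIdempotent g * (hClassSchurRing H).adjMatrix (g' * g⁻¹) *
          (hClassSchurRing H).dualIdempotent g := by
      ext x y
      have h1 : pairLabel H x y = pairLabel H g g' ↔ hClassSetoid H g x ∧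
          hClassSetoid H (g' * g⁻¹) (y * x⁻¹) ∧ hClassSetoid H g y := by
        rw [pairLabel, pairLabel, if_pos hg, hClassSetoid_iff_coset_eq hcl hgH,
          hClassSetoid_iff_coset_eq hcl hgH]
        split_ifs with hxy
        · simp only [Sum.inl.injEq, Prod.mk.injEq, hClassSetoid_mk_eq_iff]
          rw [Setoid.comm' (s := hClassSetoid H) (y := g), hClassSetoid_iff_coset_eq hcl hgH,
            Setoid.comm' (s := hClassSetoid H) (x := y * x⁻¹), ← hxy]
          tauto
        · simp only [false_iff]
          rintro ⟨h1, -, h2⟩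
          exact hxy (h1.symm.trans h2)
      rw [SchurRing.dualIdempotent_mul_mul_apply, SchurRing.adjMatrix_apply, ← ite_and,
        Matrix.of_apply]
      refine if_congr (h1.trans ?_) rfl rfl
      change _ ↔ (hClassSetoid H g x ∧ hClassSetoid H g y) ∧ hClassSetoid H (g' * g⁻¹) (y * x⁻¹)
      tauto
    rw [h]
    exact mul_mem (mul_mem (SchurRing.dualIdempotent_mem _ _) (SchurRing.adjMatrix_mem _ _))
      (SchurRing.dualIdempotent_mem _ _)
  · refine SchurRing.mem_of_const_on_classes _ _ fun x y x' y' hx hy => ?_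
    have hx' : hClassSetoid H x x' := hx
    have hy' : hClassSetoid H y y' := hy
    simp only [Matrix.of_apply]
    refine if_congr ?_ rfl rfl
    by_cases hxy : (x : G ⧸ H) = y
    · simp [pairLabel, hg, hxy, ← hClassSetoid_coset_eq hx', ← hClassSetoid_coset_eq hy']
    · simp [pairLabel, hg, hxy, ← hClassSetoid_coset_eq hx', ← hClassSetoid_coset_eq hy',
        hClassSetoid_mk_eq_iff.2 hx', hClassSetoid_mk_eq_iff.2 hy']

open scoped Classical in
/-- The matrix assembled from its `H × H` block and its values on the labels of the other pairs. -/
noncomputable def wreathMatrix (H : Subgroup G) [Fintype H] :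
    terwilligerGroup H × (outerLabels H → ℂ) →ₗ[ℂ] Matrix G G ℂ where
  toFun p := inclusionMatrix H * (p.1 : Matrix H H ℂ) * (inclusionMatrix H).transpose +
    Matrix.of fun x y => if h : pairLabel H x y ∈ outerLabels H then p.2 ⟨_, h⟩ else 0
  map_add' p q := by
    rw [Prod.fst_add, Subalgebra.coe_add, Matrix.mul_add, Matrix.add_mul, add_add_add_comm]
    congr 1
    ext x y
    by_cases h : pairLabel H x y ∈ outerLabels H <;> simp [h]
  map_smul' c p := by
    rw [Prod.smul_fst, Subalgebra.coe_smul, Matrix.mul_smul, Matrix.smul_mul, RingHom.id_apply,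
      smul_add]
    congr 1
    ext x y
    by_cases h : pairLabel H x y ∈ outerLabels H <;> simp [h]

theorem wreathMatrix_of_mem {H : Subgroup G} [H.Normal] [Fintype H]
    (p : terwilligerGroup H × (outerLabels H → ℂ)) (x y : H) :
    wreathMatrix H p x y = (p.1 : Matrix H H ℂ) x y := by
  have h : pairLabel H (x : G) y ∉ outerLabels H := by
    rw [pairLabel_mem_outerLabels, not_not]
    exact ⟨x.2, y.2⟩
  simp [wreathMatrix, inclusionMatrix_conj_of_mem, h]

theorem wreathMatrix_of_label {H : Subgroup G} [H.Normal] [Fintype H]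
    (p : terwilligerGroup H × (outerLabels H → ℂ)) {x y : G}
    (h : pairLabel H x y ∈ outerLabels H) :
    wreathMatrix H p x y = p.2 ⟨_, h⟩ := by
  have h1 := (pairLabel_mem_outerLabels x y).1 h
  simp [wreathMatrix, inclusionMatrix_conj_of_notMem H _ h1, h]

theorem wreathMatrix_injective {H : Subgroup G} [H.Normal] [Fintype H]
    (hcl : CosetsAreClasses H) : Function.Injective (wreathMatrix H) := by
  intro p q hpq
  refine Prod.ext (Subtype.ext (Matrix.ext fun x y => ?_)) (funext fun ⟨i, hi⟩ => ?_)
  · rw [← wreathMatrix_of_mem p, hpq, wreathMatrix_of_mem q]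
  · obtain ⟨x, y, rfl⟩ := exists_pairLabel_eq hcl hi
    rw [← wreathMatrix_of_label p hi, hpq, wreathMatrix_of_label q hi]

theorem wreathMatrix_mem {H : Subgroup G} [H.Normal] [Fintype H] (hcl : CosetsAreClasses H)
    (p : terwilligerGroup H × (outerLabels H → ℂ)) : wreathMatrix H p ∈ terwilligerPair H := by
  classical
  refine add_mem (inclusionMatrix_conj_mem p.1.2) ?_
  have h : (Matrix.of fun x y => if h : pairLabel H x y ∈ outerLabels H then p.2 ⟨_, h⟩ else 0) =
      ∑ i : outerLabels H,
        p.2 i • (Matrix.of fun x y => if pairLabel H x y = i then (1 : ℂ) else 0) := by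
    ext x y
    simp only [Matrix.sum_apply, Matrix.smul_apply, Matrix.of_apply, smul_eq_mul, mul_ite, mul_one,
      mul_zero]
    split_ifs with hxy
    · rw [Finset.sum_eq_single ⟨_, hxy⟩]
      · simp
      · rintro i - hi
        rw [if_neg]
        exact fun e => hi (Subtype.ext e.symm)
      · simp
    · refine (Finset.sum_eq_zero fun i _ => ?_).symm
      rw [if_neg]
      exact fun e => hxy (e ▸ i.2)
  rw [h]
  exact sum_mem fun i _ => Subalgebra.smul_mem _ (labelIndicator_mem hcl i.2) _

theorem exists_wreathMatrix_eq {H : Subgroup G} [H.Normal] [Fintype H] (hcl : CosetsAreClasses H)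
    {M : Matrix G G ℂ} (hM : M ∈ terwilligerPair H) : ∃ p, wreathMatrix H p = M := by
  have hW := isWreathMatrix_of_mem hcl hM
  -- The coordinate at a label is the entry of `M` at any pair carrying it; the choice is immaterial
  -- by `IsWreathMatrix.eq_of_pairLabel`.
  choose f g hfg using fun i : outerLabels H => exists_pairLabel_eq hcl i.2
  refine ⟨(⟨_, hW.block⟩, fun i => M (f i) (g i)), Matrix.ext fun x y => ?_⟩
  by_cases hxy : x ∈ H ∧ y ∈ H
  · exact wreathMatrix_of_mem _ ⟨x, hxy.1⟩ ⟨y, hxy.2⟩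
  · have h := (pairLabel_mem_outerLabels x y).2 hxy
    rw [wreathMatrix_of_label _ h]
    exact (hW.eq_of_pairLabel hxy (hfg ⟨_, h⟩).symm).symm

theorem finrank_terwilligerPair {H : Subgroup G} [H.Normal] [Fintype H]
    (hcl : CosetsAreClasses H) :
    Module.finrank ℂ (terwilligerPair H) =
      Module.finrank ℂ (terwilligerGroup H) + (outerLabels H).card := by
  have h : LinearMap.range (wreathMatrix H) = Subalgebra.toSubmodule (terwilligerPair H) := by
    ext M
    rw [LinearMap.mem_range, Subalgebra.mem_toSubmodule]
    exact ⟨fun ⟨p, hp⟩ => hp ▸ wreathMatrix_mem hcl p, exists_wreathMatrix_eq hcl⟩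
  have h1 := LinearMap.finrank_range_of_inj (wreathMatrix_injective hcl)
  rw [h, Module.finrank_prod, Module.finrank_fintype_fun_eq_card, Fintype.card_coe] at h1
  exact h1

end Dimension

/-! ### Frobenius groups: cosets as classes, commutativity, class counts -/

section Frobenius

variable {G : Type*} [Group G]

/-- Every coset of `H` has a representative in the abelian group `K`. -/
theorem commute_quotient_of_isComplement' {H K : Subgroup G} [H.Normal]
    (hHK : Subgroup.IsComplement' H K) [IsCyclic K] (a b : G ⧸ H) : a * b = b * a := by
  have rep : ∀ a : G ⧸ H, ∃ κ : K, ((κ : G) : G ⧸ H) = a := by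
    intro a
    induction a using QuotientGroup.induction_on with | _ g => ?_
    obtain ⟨⟨h, κ⟩, rfl⟩ := hHK.2 g
    refine ⟨κ, ?_⟩
    have h1 : ((h : G) : G ⧸ H) = 1 := (QuotientGroup.eq_one_iff _).2 h.2
    simp [h1]
  obtain ⟨x, rfl⟩ := rep a
  obtain ⟨y, rfl⟩ := rep b
  let _ := IsCyclic.commGroup (α := K)
  have h : x * y = y * x := mul_comm x y
  rw [← QuotientGroup.mk_mul, ← QuotientGroup.mk_mul, ← Subgroup.coe_mul, ← Subgroup.coe_mul, h]

variable [Fintype G]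

/-- An injective self-map of the finite set `H` is onto. Solving `g⁻¹ h⁻¹ g h = g⁻¹ x` for `h` says
precisely that `h` conjugates `g` to `x`. -/
theorem IsFrobeniusKernel.cosetsAreClasses {H : Subgroup G} (hH : IsFrobeniusKernel H) :
    CosetsAreClasses H := by
  intro g x hg hx
  have := hH.normal
  let f : H → H := fun h => ⟨g⁻¹ * (h : G)⁻¹ * g * h, by
    refine H.mul_mem ?_ h.2
    simpa using hH.normal.conj_mem _ (H.inv_mem h.2) g⁻¹⟩
  have hf : Function.Injective f := by
    intro a b hab
    have h1 : g⁻¹ * (a : G)⁻¹ * g * a = g⁻¹ * (b : G)⁻¹ * g * b := congrArg Subtype.val hab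
    have h2 : (a : G)⁻¹ * g * a = (b : G)⁻¹ * g * b := by
      simpa [mul_assoc] using h1
    by_contra hne
    have h3 : (a : G) * (b : G)⁻¹ ≠ 1 := fun e => hne (Subtype.ext (mul_inv_eq_one.1 e))
    refine hg (hH.centralizer_le _ (H.mul_mem a.2 (H.inv_mem b.2)) h3 ?_)
    rw [Subgroup.mem_centralizer_singleton_iff]
    calc g * (a * (b : G)⁻¹) = a * ((a : G)⁻¹ * g * a) * (b : G)⁻¹ := by group
      _ = a * (b : G)⁻¹ * g := by rw [h2]; group
  obtain ⟨h, hh⟩ := Finite.surjective_of_injective hf ⟨g⁻¹ * x, QuotientGroup.eq.1 hx⟩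
  refine ⟨h, h.2, ?_⟩
  have h1 : g⁻¹ * (h : G)⁻¹ * g * h = g⁻¹ * x := congrArg Subtype.val hh
  simpa [mul_assoc] using h1

/-- A pair whose cosets outside `H` are `H`-classes is a strong Gelfand pair as soon as the
quotient is abelian. -/
theorem isStrongGelfandPair_of_cosetsAreClasses {H : Subgroup G} [H.Normal]
    (hcl : CosetsAreClasses H) (hab : ∀ a b : G ⧸ H, a * b = b * a) : IsStrongGelfandPair H := by
  classical
  -- The class sum of `a ∈ H` is a sum of elements of `H`, each commuting with every class sum.
  have inner : ∀ a b : G, a ∈ H →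
      Commute (classSum (hClassSetoid H) a) (classSum (hClassSetoid H) b) := by
    intro a b ha
    refine Commute.sum_left _ _ _ fun x hx => ?_
    exact (commute_classSum_single H b x
      ((hClassSetoid_mem_iff (Finset.mem_filter.1 hx).2).1 ha)).symm
  intro a b
  change Commute (classSum (hClassSetoid H) a) (classSum (hClassSetoid H) b)
  by_cases ha : a ∈ H
  · exact inner a b ha
  by_cases hb : b ∈ H
  · exact (inner b a hb).symm
  have coeff : ∀ a b : G, a ∉ H → b ∉ H → ∀ z : G,
      (classSum (hClassSetoid H) a * classSum (hClassSetoid H) b).coeff z =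
        ∑ x : G, if (a : G ⧸ H) = x ∧ (z : G ⧸ H) = a * b then 1 else 0 := by
    intro a b ha hb z
    rw [classSum, Finset.sum_mul, MonoidAlgebra.coeff_sum, Finsupp.finsetSum_apply,
      Finset.sum_filter]
    refine Finset.sum_congr rfl fun x _ => ?_
    rw [MonoidAlgebra.coeff_single_mul_apply, coeff_classSum, one_mul, ← ite_and]
    refine if_congr ?_ rfl rfl
    rw [hClassSetoid_iff_coset_eq hcl ha, hClassSetoid_iff_coset_eq hcl hb]
    refine and_congr_right fun hx => ?_
    rw [QuotientGroup.mk_mul, QuotientGroup.mk_inv, ← hx, eq_inv_mul_iff_mul_eq, eq_comm]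
  refine MonoidAlgebra.ext (Finsupp.ext fun z => ?_)
  -- Right multiplication by `a⁻¹ b` carries the coset of `a` onto that of `b`, matching the two
  -- counts.
  rw [coeff a b ha hb, coeff b a hb ha, ← Equiv.sum_comp (Equiv.mulRight (a⁻¹ * b))
    (fun x => if (b : G ⧸ H) = x ∧ (z : G ⧸ H) = b * a then (1 : ℂ) else 0)]
  refine Finset.sum_congr rfl fun x _ => if_congr (and_congr ?_ ?_) rfl rfl
  · simp only [Equiv.coe_mulRight, QuotientGroup.mk_mul, QuotientGroup.mk_inv]
    rw [← mul_assoc, right_eq_mul, mul_inv_eq_one, eq_comm]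
  · rw [hab]

theorem card_innerClasses (H : Subgroup G) :
    (innerClasses H).card = Nat.card (ConjClasses H) := by
  classical
  have conj_iff : ∀ a b : H, IsConj a b ↔ hClassSetoid H (a : G) b := by
    intro a b
    rw [isConj_iff, hClassSetoid_coe_iff]
    exact ⟨fun ⟨c, hc⟩ => ⟨c⁻¹, trivial, by simpa using hc⟩,
      fun ⟨c, _, hc⟩ => ⟨c⁻¹, by simpa using hc⟩⟩
  let f : ConjClasses H → innerClasses H := Quotient.lift
    (fun a : H => ⟨Quotient.mk _ (a : G), mk_mem_innerClasses.2 a.2⟩)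
    fun a b h => Subtype.ext (Quotient.sound ((conj_iff a b).1 h))
  have hf : Function.Bijective f := by
    constructor
    · intro a b
      induction a using Quotient.inductionOn with | _ a => ?_
      induction b using Quotient.inductionOn with | _ b => ?_
      intro h
      exact Quotient.sound ((conj_iff a b).2 (hClassSetoid_mk_eq_iff.1 (congrArg Subtype.val h)))
    · rintro ⟨c, hc⟩
      induction c using Quotient.inductionOn with | _ x => ?_
      exact ⟨Quotient.mk _ ⟨x, mk_mem_innerClasses.1 hc⟩, rfl⟩
  rw [Nat.card_congr (Equiv.ofBijective f hf), Nat.card_eq_fintype_card, Fintype.card_coe]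

/-- Outer classes are the non-identity elements of `G ⧸ H`; the extra `1` is `H` itself. -/
theorem card_outerClasses {H : Subgroup G} [H.Normal] (hcl : CosetsAreClasses H) :
    (outerClasses H).card + 1 = H.index := by
  classical
  have h : (outerClasses H).card = ((Finset.univ : Finset (G ⧸ H)).erase 1).card := by
    refine Finset.card_bij
      (fun c _ => Quotient.lift (fun x : G => (x : G ⧸ H)) (fun _ _ => hClassSetoid_coset_eq) c)
      ?_ ?_ ?_
    · intro c hc
      induction c using Quotient.inductionOn with | _ x => ?_
      simpa [QuotientGroup.eq_one_iff] using mk_mem_outerClasses.1 hc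
    · intro c hc d _ hcd
      induction c using Quotient.inductionOn with | _ x => ?_
      induction d using Quotient.inductionOn with | _ y => ?_
      exact Quotient.sound (hcl x y (mk_mem_outerClasses.1 hc) hcd)
    · intro q hq
      induction q using QuotientGroup.induction_on with | _ x => ?_
      refine ⟨Quotient.mk _ x, mk_mem_outerClasses.2 fun hx => ?_, rfl⟩
      exact (Finset.mem_erase.1 hq).1 ((QuotientGroup.eq_one_iff x).2 hx)
  rw [h, Finset.card_erase_add_one (Finset.mem_univ _), Finset.card_univ, Subgroup.index,
    Nat.card_eq_fintype_card]

end Frobenius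

theorem proposition3p14 {G : Type*} [Group G] [Fintype G] [DecidableEq G]
    (H K : Subgroup G) [Fintype H] (hH : IsFrobeniusKernel H)
    (hHK : Subgroup.IsComplement' H K) (hK : IsCyclic K)
    (k m : ℕ) (hk : Nat.card K = k) (hm : Nat.card (ConjClasses H) = m)
    (hAC : IsAlmostCommutative (terwilligerGroup H) 1) :
    IsStrongGelfandPair H ∧
      (Module.finrank ℂ (terwilligerPair H) : ℤ) =
        Module.finrank ℂ (terwilligerGroup H) + ((k : ℤ) - 1) * ((k : ℤ) - 2 + 3 * (m : ℤ)) := by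
  have := hH.normal
  have hcl := hH.cosetsAreClasses
  refine ⟨isStrongGelfandPair_of_cosetsAreClasses hcl (commute_quotient_of_isComplement' hHK), ?_⟩
  have hB := card_outerClasses hcl
  rw [hHK.symm.index_eq_card, hk] at hB
  -- The off-diagonal count is a truncated subtraction; this bound makes it an honest one in `ℤ`.
  have hle : (outerClasses H).card ≤ (outerClasses H).card * (outerClasses H).card :=
    Nat.le_mul_self _
  rw [finrank_terwilligerPair hcl, card_outerLabels, card_innerClasses, hm, ← hB]
  push_cast [Nat.cast_sub hle]
  ring
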